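/- Let $\mathcal A$ be a central hyperplane arrangement, i.e. a finite nonempty set of codimension-one linear subspaces of $\mathbb R^n$. Its regions are the closures of the connected components of $\mathbb R^n\setminus\bigcup_{H\in\mathcal A}H$. Fix a base region $B$. For a region $R$ let $S(R)$ be the set of hyperplanes of $\mathcal A$ separating $R$ from $B$, and let $\mathcal P(\mathcal A,B)$ be the poset of all regions with $R_1\le R_2$ if and only if $S(R_1)\subseteq S(R_2)$. A rank-two subarrangement is a set $\mathcal A'\subseteq\mathcal A$ with $|\mathcal A'|>1$ consisting of all $H\in\mathcal A$ that contain some fixed codimension-two subspace $L$. A hyperplane $H\in\mathcal A'$ is basic in $\mathcal A'$ if it bounds the region $B'$ of $\mathcal A'$ containing $B$, i.e. $H\cap B'$ has codimension one. For $H\in\mathcal A$, remove from $H$ the subspace $L$ of every rank-two subarrangement that contains $H$ and in which $H$ is not basic; the connected components of what remains of the hyperplanes $H\in\mathcal A$ are the shards of $(\mathcal A,B)$. For a shard $\Sigma$, let $H_\Sigma$ be the hyperplane of $\mathcal A$ containing it; let $U(\Sigma)$ (respectively $L(\Sigma)$) be the set of regions $R$ such that $R\cap\Sigma$ has codimension one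 and $H_\Sigma\in S(R)$ (respectively $H_\Sigma\notin S(R)$), viewed as subposets of $\mathcal P(\mathcal A,B)$. A pair $(j,m)$ of elements of a poset is subcritical if $j\not\le m$, every $x<j$ satisfies $x\le m$, and every $x>m$ satisfies $x\ge j$. Proposition. If a region $J$ is minimal in $U(\Sigma)$ for some shard $\Sigma$, then $J$ covers exactly one region in $\mathcal P(\mathcal A,B)$, denoted $J_*$. A pair $(J,M)$ of regions is subcritical in $\mathcal P(\mathcal A,B)$ if and only if there is a shard $\Sigma$ such that $J$ is minimal in $U(\Sigma)$, $M$ is maximal in $L(\Sigma)$ and $J_*\le M$. -/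

import Mathlib

namespace RegionPoset

/-- The ambient space `ℝⁿ`. -/
abbrev Euc (n : ℕ) : Type := EuclideanSpace ℝ (Fin n)

/-- A (central) arrangement: a finite, nonempty collection of linear hyperplanes
(codimension-one linear subspaces) of `ℝⁿ`. -/
structure CentralArrangement (n : ℕ) where
  hyperplanes : Set (Submodule ℝ (Euc n))
  finite : hyperplanes.Finite
  nonempty : hyperplanes.Nonempty
  codim_one : ∀ H ∈ hyperplanes, Module.finrank ℝ H + 1 = n

section Geometry

variable {n : ℕ}

/-- The complement of the union of a collection of subspaces. -/
def complement (𝓗 : Set (Submodule ℝ (Euc n))) : Set (Euc n) :=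
  {x | ∀ H ∈ 𝓗, x ∉ H}

/-- `R` is a region of the collection `𝓗`: the closure of a connected component of the
complement of the union of the hyperplanes. -/
def IsRegion (𝓗 : Set (Submodule ℝ (Euc n))) (R : Set (Euc n)) : Prop :=
  ∃ x ∈ complement 𝓗, R = closure (connectedComponentIn (complement 𝓗) x)

/-- `H` separates `R₁` from `R₂`: they lie in the two opposite closed half-spaces bounded
by `H`. -/
def Separates (H : Submodule ℝ (Euc n)) (R₁ R₂ : Set (Euc n)) : Prop :=
  ∃ f : Euc n →ₗ[ℝ] ℝ, LinearMap.ker f = H ∧ (∀ x ∈ R₁, 0 ≤ f x) ∧ (∀ x ∈ R₂, f x ≤ 0)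

/-- The nonempty set `T` has codimension one in `ℝⁿ`; the dimension of a (convex) set is the
dimension of its affine span. -/
def HasCodimOne (T : Set (Euc n)) : Prop :=
  T.Nonempty ∧ Module.finrank ℝ (vectorSpan ℝ T) + 1 = n

/-- The functional `f` has constant strict sign on a connected set that avoids its kernel. -/
theorem sign_on_component {𝓗 : Set (Submodule ℝ (Euc n))} {H : Submodule ℝ (Euc n)}
    (hH : H ∈ 𝓗) (f : Euc n →ₗ[ℝ] ℝ) (hf : LinearMap.ker f = H) {x y : Euc n}
    (hy : y ∈ connectedComponentIn (complement 𝓗) x) (hx : 0 < f x) : 0 < f y := by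
  by_contra hcon
  push Not at hcon
  have hxC : x ∈ complement 𝓗 := by
    by_contra h
    rw [connectedComponentIn_eq_empty h] at hy
    exact hy
  have hc : ContinuousOn f (connectedComponentIn (complement 𝓗) x) :=
    (LinearMap.continuous_of_finiteDimensional f).continuousOn
  obtain ⟨z, hz, hz0⟩ := isPreconnected_connectedComponentIn.intermediate_value hy
    (mem_connectedComponentIn hxC) hc ⟨hcon, hx.le⟩
  refine connectedComponentIn_subset _ _ hz H hH ?_
  rw [← hf]
  exact hz0

theorem nonneg_on_region {𝓗 : Set (Submodule ℝ (Euc n))} {H : Submodule ℝ (Euc n)}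
    (hH : H ∈ 𝓗) (f : Euc n →ₗ[ℝ] ℝ) (hf : LinearMap.ker f = H) {x : Euc n} (hx : 0 < f x) :
    ∀ y ∈ closure (connectedComponentIn (complement 𝓗) x), 0 ≤ f y := by
  intro y hy
  have hcl : IsClosed {z : Euc n | 0 ≤ f z} :=
    isClosed_le continuous_const (LinearMap.continuous_of_finiteDimensional f)
  exact closure_minimal (fun z hz => (sign_on_component hH f hf hz hx).le) hcl hy

theorem separates_iff {𝓗 : Set (Submodule ℝ (Euc n))} {H : Submodule ℝ (Euc n)}
    (hH : H ∈ 𝓗) (f : Euc n →ₗ[ℝ] ℝ) (hf : LinearMap.ker f = H) {x y : Euc n}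
    (hx : x ∈ complement 𝓗) (hy : y ∈ complement 𝓗) :
    Separates H (closure (connectedComponentIn (complement 𝓗) x))
      (closure (connectedComponentIn (complement 𝓗) y)) ↔ f x * f y < 0 := by
  have hneg : LinearMap.ker (-f) = H := by
    rw [← hf]; ext z; simp
  constructor
  · rintro ⟨g, hg, hgx, hgy⟩
    have h1 := hgx x (subset_closure (mem_connectedComponentIn hx))
    have h2 := hgy y (subset_closure (mem_connectedComponentIn hy))
    have h3 : g x ≠ 0 := fun h => hx H hH (by rw [← hg]; exact h)
    have h4 : g y ≠ 0 := fun h => hy H hH (by rw [← hg]; exact h)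
    have h5 : f x ≠ 0 := fun h => hx H hH (by rw [← hf]; exact h)
    have h1' : 0 < g x := lt_of_le_of_ne h1 (Ne.symm h3)
    have h2' : g y < 0 := lt_of_le_of_ne h2 h4
    have hw : f y • x - f x • y ∈ LinearMap.ker g := by
      rw [hg, ← hf, LinearMap.mem_ker]
      simp only [map_sub, map_smul, smul_eq_mul]
      ring
    rw [LinearMap.mem_ker] at hw
    simp only [map_sub, map_smul, smul_eq_mul] at hw
    have h6 : f x * f y * g x = f x ^ 2 * g y := by linear_combination f x * hw
    have h7 : f x ^ 2 * g y < 0 := mul_neg_of_pos_of_neg (by positivity) h2'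
    by_contra h
    push Not at h
    have := mul_nonneg h h1
    linarith
  · intro h
    rcases mul_neg_iff.1 h with ⟨h1, h2⟩ | ⟨h1, h2⟩
    · refine ⟨f, hf, nonneg_on_region hH f hf h1, fun z hz => ?_⟩
      have := nonneg_on_region hH (-f) hneg (x := y) (by simpa using h2) z hz
      simpa using this
    · refine ⟨-f, hneg, nonneg_on_region hH (-f) hneg (by simpa using h1), fun z hz => ?_⟩
      have := nonneg_on_region hH f hf h2 z hz
      simpa using this

theorem exists_functional {H : Submodule ℝ (Euc n)} (hH : Module.finrank ℝ H + 1 = n) :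
    ∃ f : Euc n →ₗ[ℝ] ℝ, LinearMap.ker f = H := by
  have h1 : Module.finrank ℝ (Euc n ⧸ H) = Module.finrank ℝ ℝ := by
    have := H.finrank_quotient_add_finrank
    rw [finrank_euclideanSpace_fin] at this
    rw [Module.finrank_self]
    omega
  let e := LinearEquiv.ofFinrankEq (Euc n ⧸ H) ℝ h1
  refine ⟨e.toLinearMap ∘ₗ H.mkQ, ?_⟩
  rw [LinearEquiv.ker_comp, Submodule.ker_mkQ]

end Geometry

variable {n : ℕ}

/-- The regions of a central arrangement. -/
def Region (A : CentralArrangement n) : Type :=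
  {R : Set (Euc n) // IsRegion A.hyperplanes R}

/-- The separating set `S(R) = S(R, B)`. -/
def sepSet (A : CentralArrangement n) (B R : Region A) : Set (Submodule ℝ (Euc n)) :=
  {H | H ∈ A.hyperplanes ∧ Separates H R.1 B.1}

theorem sepSet_injective (A : CentralArrangement n) (B : Region A) :
    Function.Injective (sepSet A B) := by
  rintro ⟨_, x, hx, rfl⟩ ⟨_, y, hy, rfl⟩ h
  obtain ⟨_, b, hb, rfl⟩ := B
  have key : y ∈ connectedComponentIn (complement A.hyperplanes) x := by
    have hseg : segment ℝ x y ⊆ complement A.hyperplanes := by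
      rintro z ⟨s, t, hs, ht, hst, rfl⟩ H hH hz
      obtain ⟨f, hf⟩ := exists_functional (A.codim_one H hH)
      have h1 := separates_iff hH f hf hx hb
      have h2 := separates_iff hH f hf hy hb
      have h3 := Set.ext_iff.1 h H
      simp only [sepSet, Set.mem_ofPred_eq, hH, true_and] at h3
      have h4 : f x * f b < 0 ↔ f y * f b < 0 := h1.symm.trans (h3.trans h2)
      have hx0 : f x ≠ 0 := fun h => hx H hH (by rw [← hf]; exact h)
      have hy0 : f y ≠ 0 := fun h => hy H hH (by rw [← hf]; exact h)
      have hb0 : f b ≠ 0 := fun h => hb H hH (by rw [← hf]; exact h)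
      rw [← hf, LinearMap.mem_ker] at hz
      simp only [map_add, map_smul, smul_eq_mul] at hz
      have hpos : 0 < f x * f y := by
        rcases lt_or_gt_of_ne hx0 with hx1 | hx1 <;> rcases lt_or_gt_of_ne hy0 with hy1 | hy1 <;>
          rcases lt_or_gt_of_ne hb0 with hb1 | hb1 <;>
          first
            | exact mul_pos hx1 hy1
            | exact mul_pos_of_neg_of_neg hx1 hy1
            | (exfalso; have := h4.1 (mul_neg_of_neg_of_pos hx1 hb1)
               have := mul_pos hy1 hb1; linarith)
            | (exfalso; have := h4.2 (mul_neg_of_neg_of_pos hy1 hb1)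
               have := mul_pos hx1 hb1; linarith)
            | (exfalso; have := h4.1 (mul_neg_of_pos_of_neg hx1 hb1)
               have := mul_pos_of_neg_of_neg hy1 hb1; linarith)
            | (exfalso; have := h4.2 (mul_neg_of_pos_of_neg hy1 hb1)
               have := mul_pos_of_neg_of_neg hx1 hb1; linarith)
      have h5 : s * f x ^ 2 + t * (f x * f y) = 0 := by linear_combination f x * hz
      have hx2 : 0 < f x ^ 2 := by positivity
      have h6 : 0 ≤ s * f x ^ 2 := by positivity
      have h7 : 0 ≤ t * (f x * f y) := mul_nonneg ht hpos.le
      have hs0 : s = 0 := by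
        have : s * f x ^ 2 = 0 := by linarith
        exact (mul_eq_zero.1 this).resolve_right hx2.ne'
      have ht0 : t = 0 := by
        have : t * (f x * f y) = 0 := by linarith
        exact (mul_eq_zero.1 this).resolve_right hpos.ne'
      linarith
    exact (convex_segment x y).isPreconnected.subset_connectedComponentIn
      (left_mem_segment ℝ x y) hseg (right_mem_segment ℝ x y)
  apply Subtype.ext
  show closure _ = closure _
  rw [connectedComponentIn_eq key]

/-- The poset of regions `𝓟(A, B)`: the regions of `A`, ordered by inclusion of separating
sets with respect to the base region `B`. -/
def PosetOfRegions (A : CentralArrangement n) (_B : Region A) : Type := Region A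

instance (A : CentralArrangement n) (B : Region A) : PartialOrder (PosetOfRegions A B) :=
  PartialOrder.lift (sepSet A B) (sepSet_injective A B)

/-- `𝓗'` is the rank-two subarrangement of `A` defined by the codimension-two subspace `L`. -/
def IsRankTwoSubarrangement (A : CentralArrangement n) (𝓗' : Set (Submodule ℝ (Euc n)))
    (L : Submodule ℝ (Euc n)) : Prop :=
  Module.finrank ℝ L + 2 = n ∧ 𝓗' = {H | H ∈ A.hyperplanes ∧ L ≤ H} ∧ 𝓗'.Nontrivial

/-- `H` is basic in `𝓗'` (with respect to `B`): it bounds (i.e. contains a facet of) the region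
`B'` of `𝓗'` that contains `B`. -/
def IsBasic {A : CentralArrangement n} (B : Region A) (𝓗' : Set (Submodule ℝ (Euc n)))
    (H : Submodule ℝ (Euc n)) : Prop :=
  H ∈ 𝓗' ∧ ∃ B' : Set (Euc n), IsRegion 𝓗' B' ∧ B.1 ⊆ B' ∧ HasCodimOne (B' ∩ (H : Set (Euc n)))

/-- What is left of the hyperplane `H` after cutting it: for every rank-two subarrangement that
contains `H` and in which `H` is not basic, its defining subspace `L` is removed from `H`. -/
def cutHyperplane {A : CentralArrangement n} (B : Region A) (H : Submodule ℝ (Euc n)) :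
    Set (Euc n) :=
  {x | x ∈ H ∧ ∀ (𝓗' : Set (Submodule ℝ (Euc n))) (L : Submodule ℝ (Euc n)),
    IsRankTwoSubarrangement A 𝓗' L → H ∈ 𝓗' → ¬ IsBasic B 𝓗' H → x ∉ L}

/-- A shard `Σ` of `A` with respect to `B`: a connected component of a cut hyperplane, recorded
together with the hyperplane `H_Σ` of `A` that contains it. -/
structure Shard (A : CentralArrangement n) (B : Region A) where
  hyperplane : Submodule ℝ (Euc n)
  hyperplane_mem : hyperplane ∈ A.hyperplanes
  carrier : Set (Euc n)
  isComponent : ∃ x ∈ cutHyperplane B hyperplane,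
    carrier = connectedComponentIn (cutHyperplane B hyperplane) x

/-- `U(Σ)`: the regions that intersect `Σ` in codimension one and have `H_Σ ∈ S(R)`. -/
def upperRegions {A : CentralArrangement n} {B : Region A} (σ : Shard A B) :
    Set (PosetOfRegions A B) :=
  {R | HasCodimOne (R.1 ∩ σ.carrier) ∧ σ.hyperplane ∈ sepSet A B R}

/-- `L(Σ)`: the regions that intersect `Σ` in codimension one and have `H_Σ ∉ S(R)`. -/
def lowerRegions {A : CentralArrangement n} {B : Region A} (σ : Shard A B) :
    Set (PosetOfRegions A B) :=
  {R | HasCodimOne (R.1 ∩ σ.carrier) ∧ σ.hyperplane ∉ sepSet A B R}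

/-- Subcritical pairs of a poset. -/
def IsSubcritical {P : Type*} [PartialOrder P] (j m : P) : Prop :=
  ¬ j ≤ m ∧ (∀ x, x < j → x ≤ m) ∧ (∀ x, m < x → j ≤ x)

/-- `k` is the element `j_*`: the one and only element covered by `j`. -/
def IsLowerStar {P : Type*} [PartialOrder P] (j k : P) : Prop :=
  k ⋖ j ∧ ∀ k', k' ⋖ j → k' = k

end RegionPoset

/-! Fix an interior point `b` of `B` and normals `N.f H` that are positive at `b`. Then `S(R)` is
the set of hyperplanes whose normal is negative at an interior point of `R`, and regions, facets and
shards can be handled through signs of functionals at points. A region meets a shard of `H` in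
codimension one exactly when the shard contains a facet point of that region: a point on `H`, on no
other hyperplane, with the signs of the region off `H`.

Two geometric facts carry the proof. First (`segment_subset`), a segment in `H` between facet points
whose separating sets off `H` are nested is never cut, so both ends lie in one shard. Second
(`exists_projection`), a generic interior point slides onto `H` along the direction `b`. Sliding
towards `b` can only shrink the separating set off `H`; sliding away can only enlarge it.

Together they show that if `K` lies below a member of `U(Σ)` and has `H_Σ` in its separating set,
then `K` lies above a member of `U(Σ)`; dually for `L(Σ)`. So a region strictly below a minimal `J`
loses `H_Σ`, and one strictly above a maximal `M` gains it. Since the region across the facet has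
separating set `S(J) \ {H_Σ}`, it is `J_*` and lies above everything strictly below `J`. With `J_* ≤
M` this gives subcriticality.

Conversely, for a subcritical pair, take a lower facet of `J` on `H` and an upper facet of `M` on
`H'`. The regions across them force `S(J) \ {H} ⊆ S(M)` and `H = H'`, so the two facet points lie in
one shard; minimality and maximality follow from subcriticality. -/

namespace RegionPoset

variable {n : ℕ}

/-! ### Sign conditions, regions as polyhedral cones, and codimension one -/

/-- Points on the same strict side of every hyperplane lie in the same component of the
complement. -/
theorem mem_component_of_same_sign {𝓗 : Set (Submodule ℝ (Euc n))}
    (f : Submodule ℝ (Euc n) → Euc n →ₗ[ℝ] ℝ) (hf : ∀ H ∈ 𝓗, LinearMap.ker (f H) = H)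
    {x y : Euc n} (h : ∀ H ∈ 𝓗, 0 < f H x * f H y) :
    y ∈ connectedComponentIn (complement 𝓗) x := by
  have hseg : segment ℝ x y ⊆ complement 𝓗 := by
    rintro z ⟨s, t, hs, ht, hst, rfl⟩ H hH hz
    have hxy := h H hH
    have hx2 : 0 < f H x ^ 2 := by
      have : f H x ≠ 0 := left_ne_zero_of_mul hxy.ne'
      positivity
    rw [← hf H hH, LinearMap.mem_ker] at hz
    simp only [map_add, map_smul, smul_eq_mul] at hz
    have h5 : s * f H x ^ 2 + t * (f H x * f H y) = 0 := by linear_combination f H x * hz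
    have hsum : 0 < s * f H x ^ 2 + t * (f H x * f H y) := by
      rcases hs.eq_or_lt with rfl | hs
      · have : t = 1 := by linarith
        subst this; linarith
      · have := mul_pos hs hx2
        have := mul_nonneg ht hxy.le
        linarith
    linarith
  exact (convex_segment x y).isPreconnected.subset_connectedComponentIn
    (left_mem_segment ℝ x y) hseg (right_mem_segment ℝ x y)

/-- A region is the closed polyhedral cone cut out by the signs of an interior point. -/
theorem mem_closure_component_iff {𝓗 : Set (Submodule ℝ (Euc n))}
    (f : Submodule ℝ (Euc n) → Euc n →ₗ[ℝ] ℝ) (hf : ∀ H ∈ 𝓗, LinearMap.ker (f H) = H)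
    {x : Euc n} (hx : x ∈ complement 𝓗) (y : Euc n) :
    y ∈ closure (connectedComponentIn (complement 𝓗) x) ↔ ∀ H ∈ 𝓗, 0 ≤ f H x * f H y := by
  have hx0 : ∀ H ∈ 𝓗, f H x ≠ 0 := fun H hH h => hx H hH (by rw [← hf H hH]; exact h)
  constructor
  · intro hy H hH
    rcases lt_or_gt_of_ne (hx0 H hH) with h | h
    · have hneg : LinearMap.ker (-f H) = H := by
        rw [← hf H hH]; ext z; simp [hf H hH]
      have := nonneg_on_region hH (-f H) hneg (x := x) (by simpa using h) y hy
      simp only [LinearMap.neg_apply] at this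
      nlinarith
    · exact mul_nonneg h.le (nonneg_on_region hH (f H) (hf H hH) h y hy)
  · intro h
    -- Pushing `y` slightly towards the interior point `x` makes every weak sign condition strict.
    have hmem : ∀ᶠ ε : ℝ in nhdsWithin 0 (Set.Ioi 0),
        y + ε • x ∈ connectedComponentIn (complement 𝓗) x := by
      filter_upwards [self_mem_nhdsWithin] with ε hε
      refine mem_component_of_same_sign f hf fun H hH => ?_
      have h1 := h H hH
      have h2 : 0 < f H x ^ 2 := by have := hx0 H hH; positivity
      have h3 := mul_pos (Set.mem_Ioi.1 hε) h2
      simp only [map_add, map_smul, smul_eq_mul]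
      nlinarith
    have hlim : Filter.Tendsto (fun ε : ℝ => y + ε • x) (nhdsWithin 0 (Set.Ioi 0)) (nhds y) := by
      have : Continuous fun ε : ℝ => y + ε • x := by fun_prop
      simpa using (this.tendsto 0).mono_left nhdsWithin_le_nhds
    exact mem_closure_of_tendsto hlim hmem

/-- Finitely many open sign conditions persist under a small displacement. -/
theorem exists_pos_same_sign {ι : Type*} {s : Set ι} (hs : s.Finite) (g : ι → Euc n →ₗ[ℝ] ℝ)
    (p v : Euc n) (h : ∀ i ∈ s, g i p ≠ 0) :
    ∃ ε > (0 : ℝ), ∀ i ∈ s, 0 < g i p * g i (p + ε • v) := by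
  have : ∀ᶠ ε : ℝ in nhdsWithin 0 (Set.Ioi 0), ∀ i ∈ s, 0 < g i p * g i (p + ε • v) := by
    rw [Set.Finite.eventually_all hs]
    intro i hi
    have hc : Continuous fun ε : ℝ => g i p * g i (p + ε • v) := by
      have := LinearMap.continuous_of_finiteDimensional (g i)
      fun_prop
    refine (hc.tendsto 0).eventually_mem ?_ |>.filter_mono nhdsWithin_le_nhds
    refine Ioi_mem_nhds ?_
    have := h i hi
    have : 0 < g i p ^ 2 := by positivity
    simpa [sq] using this
  obtain ⟨ε, h1, h2⟩ := (this.and self_mem_nhdsWithin).exists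
  exact ⟨ε, h2, h1⟩

/-- A finite family of nonzero functionals has a common nonvanishing point. -/
theorem exists_forall_apply_ne_zero {ι : Type*} {s : Set ι} (hs : s.Finite)
    (g : ι → Euc n →ₗ[ℝ] ℝ) (h : ∀ i ∈ s, g i ≠ 0) : ∃ v, ∀ i ∈ s, g i v ≠ 0 := by
  classical
  have := Subspace.biUnion_ne_univ_of_top_notMem
    (s := hs.toFinset.image fun i => LinearMap.ker (g i)) (by
      simp only [Finset.mem_image, Set.Finite.mem_toFinset, not_exists, not_and]
      intro i hi h0
      exact h i hi (LinearMap.ker_eq_top.1 h0))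
  obtain ⟨v, hv⟩ := (Set.ne_univ_iff_exists_notMem _).1 this
  refine ⟨v, fun i hi h0 => hv ?_⟩
  simp only [Finset.mem_image, Set.Finite.mem_toFinset, Set.mem_iUnion]
  exact ⟨_, ⟨i, hi, rfl⟩, h0⟩

/-- A subset of a hyperplane `H` containing the points of `H` that satisfy the same strict sign
conditions as some point of `H` has codimension one. -/
theorem hasCodimOne_of_same_sign {ι : Type*} {s : Set ι} (hs : s.Finite)
    (g : ι → Euc n →ₗ[ℝ] ℝ) {H : Submodule ℝ (Euc n)} (hH : Module.finrank ℝ H + 1 = n)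
    {T : Set (Euc n)} (hT : T ⊆ H) {p : Euc n} (hp : p ∈ H) (hg : ∀ i ∈ s, g i p ≠ 0)
    (h : ∀ y ∈ H, (∀ i ∈ s, 0 < g i p * g i y) → y ∈ T) : HasCodimOne T := by
  have hpT : p ∈ T := h p hp fun i hi => by
    have := hg i hi
    rw [← sq]; positivity
  have : vectorSpan ℝ T = H := by
    apply le_antisymm
    · rw [vectorSpan, Submodule.span_le]
      rintro _ ⟨a, ha, c, hc, rfl⟩
      exact H.sub_mem (hT ha) (hT hc)
    · intro v hv
      obtain ⟨ε, hε, h1⟩ := exists_pos_same_sign hs g p v hg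
      have h2 := vsub_mem_vectorSpan ℝ (h _ (H.add_mem hp (H.smul_mem ε hv)) h1) hpT
      have h3 := Submodule.smul_mem _ ε⁻¹ h2
      simpa [hε.ne'] using h3
  exact ⟨⟨p, hpT⟩, by rw [this]; exact hH⟩

/-- A hyperplane containing a set of codimension one inside another hyperplane is equal to it. -/
theorem eq_of_hasCodimOne {H K : Submodule ℝ (Euc n)} (hH : Module.finrank ℝ H + 1 = n)
    (hK : Module.finrank ℝ K + 1 = n) {T : Set (Euc n)} (hT : HasCodimOne T)
    (hTH : T ⊆ H) (hTK : T ⊆ K) : K = H := by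
  have key : ∀ H' : Submodule ℝ (Euc n), Module.finrank ℝ H' + 1 = n → T ⊆ H' →
      vectorSpan ℝ T = H' := by
    intro H' h1 h2
    apply Submodule.eq_of_le_of_finrank_eq
    · rw [vectorSpan, Submodule.span_le]
      rintro _ ⟨a, ha, c, hc, rfl⟩
      exact H'.sub_mem (h2 ha) (h2 hc)
    · have := hT.2; omega
  rw [← key H hH hTH, ← key K hK hTK]

/-! ### Normals positive on the base region, and generic interior points -/

/-- Normal functionals of the hyperplanes of `A`, positive at an interior point `b` of `B`. -/
structure Normals (A : CentralArrangement n) (B : Region A) where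
  b : Euc n
  f : Submodule ℝ (Euc n) → Euc n →ₗ[ℝ] ℝ
  b_mem : b ∈ complement A.hyperplanes
  base_eq : B.1 = closure (connectedComponentIn (complement A.hyperplanes) b)
  ker_eq : ∀ H ∈ A.hyperplanes, LinearMap.ker (f H) = H
  pos : ∀ H ∈ A.hyperplanes, 0 < f H b

theorem exists_normals (A : CentralArrangement n) (B : Region A) : Nonempty (Normals A B) := by
  obtain ⟨b, hb, hB⟩ := B.2
  have : ∀ H : Submodule ℝ (Euc n), ∃ f : Euc n →ₗ[ℝ] ℝ,
      H ∈ A.hyperplanes → LinearMap.ker f = H ∧ 0 < f b := by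
    intro H
    by_cases hH : H ∈ A.hyperplanes
    · obtain ⟨f, hf⟩ := exists_functional (A.codim_one H hH)
      have h0 : f b ≠ 0 := fun h => hb H hH (by rw [← hf]; exact h)
      rcases lt_or_gt_of_ne h0 with h | h
      · refine ⟨-f, fun _ => ⟨?_, by simpa using h⟩⟩
        rw [← hf]; ext z; simp
      · exact ⟨f, fun _ => ⟨hf, h⟩⟩
    · exact ⟨0, fun h => absurd h hH⟩
  choose f hf using this
  exact ⟨⟨b, f, hb, hB, fun H hH => (hf H hH).1, fun H hH => (hf H hH).2⟩⟩

section Facets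

variable {A : CentralArrangement n} {B : Region A}

theorem Normals.apply_eq_zero_iff (N : Normals A B) {H : Submodule ℝ (Euc n)}
    (hH : H ∈ A.hyperplanes) {x : Euc n} : N.f H x = 0 ↔ x ∈ H := by
  conv_rhs => rw [← N.ker_eq H hH]
  exact LinearMap.mem_ker.symm

theorem Normals.mem_sepSet_iff (N : Normals A B) {R : Region A} {x : Euc n}
    (hx : x ∈ complement A.hyperplanes)
    (hR : R.1 = closure (connectedComponentIn (complement A.hyperplanes) x))
    {H : Submodule ℝ (Euc n)} (hH : H ∈ A.hyperplanes) :
    H ∈ sepSet A B R ↔ N.f H x < 0 := by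
  have h1 := separates_iff hH (N.f H) (N.ker_eq H hH) hx N.b_mem
  rw [← hR, ← N.base_eq] at h1
  have h2 := N.pos H hH
  simp only [sepSet, Set.mem_ofPred_eq, hH, true_and, h1]
  constructor
  · intro h; by_contra h3
    have := mul_nonneg (not_lt.1 h3) h2.le
    linarith
  · intro h; exact mul_neg_of_neg_of_pos h h2

theorem sepSet_subset (R : Region A) : sepSet A B R ⊆ A.hyperplanes := fun _ h => h.1

theorem le_iff_sepSet_subset {R R' : PosetOfRegions A B} :
    R ≤ R' ↔ sepSet A B R ⊆ sepSet A B R' := Iff.rfl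

/-- Every region has an interior point such that the line through it in direction `b` crosses
the hyperplanes one at a time. -/
theorem Normals.exists_generic (N : Normals A B) (R : Region A) :
    ∃ x ∈ complement A.hyperplanes,
      (R.1 = closure (connectedComponentIn (complement A.hyperplanes) x)) ∧
      ∀ H ∈ A.hyperplanes, ∀ K ∈ A.hyperplanes, K ≠ H →
        N.f K x * N.f H N.b ≠ N.f H x * N.f K N.b := by
  obtain ⟨x, hx, hR⟩ := R.2
  -- `g (H, K)` vanishes at `x` exactly when the line `x + ℝ b` meets `H` and `K` at the same
  -- parameter. It is nonzero as a functional because proportional normals would give `K = H`.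
  let g : Submodule ℝ (Euc n) × Submodule ℝ (Euc n) → Euc n →ₗ[ℝ] ℝ :=
    fun i => N.f i.1 N.b • N.f i.2 - N.f i.2 N.b • N.f i.1
  let s : Set (Submodule ℝ (Euc n) × Submodule ℝ (Euc n)) :=
    {i | i ∈ A.hyperplanes ×ˢ A.hyperplanes ∧ i.2 ≠ i.1}
  have hs : s.Finite := (A.finite.prod A.finite).subset fun i hi => hi.1
  have hg : ∀ i ∈ s, g i ≠ 0 := by
    rintro ⟨H, K⟩ ⟨⟨hH, hK⟩, hne⟩ h0
    apply hne
    have h1 : ∀ v, N.f H N.b * N.f K v = N.f K N.b * N.f H v := fun v => by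
      have := LinearMap.congr_fun h0 v
      simp only [g, LinearMap.sub_apply, LinearMap.smul_apply, smul_eq_mul,
        LinearMap.zero_apply] at this
      linarith
    ext v
    have hHp := (N.pos H hH).ne'
    have hKp := (N.pos K hK).ne'
    have := h1 v
    rw [← N.apply_eq_zero_iff hH, ← N.apply_eq_zero_iff hK]
    constructor <;> intro h <;> rw [h] at this <;> simpa [hHp, hKp] using this
  obtain ⟨v, hv⟩ := exists_forall_apply_ne_zero hs g hg
  have hx0 : ∀ H ∈ A.hyperplanes, N.f H x ≠ 0 := fun H hH h =>
    hx H hH ((N.apply_eq_zero_iff hH).1 h)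
  have hcomp : ∀ y : Euc n, (∀ H ∈ A.hyperplanes, 0 < N.f H x * N.f H y) →
      y ∈ complement A.hyperplanes ∧
      R.1 = closure (connectedComponentIn (complement A.hyperplanes) y) := by
    intro y hy
    have := mem_component_of_same_sign N.f N.ker_eq hy
    exact ⟨connectedComponentIn_subset _ _ this, by rw [hR, connectedComponentIn_eq this]⟩
  obtain ⟨ε, hε, h1⟩ := exists_pos_same_sign A.finite N.f x v hx0
  have hfin : ∀ᶠ t : ℝ in nhdsWithin 0 (Set.Ioi 0), ∀ i ∈ s, g i (x + t • v) ≠ 0 := by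
    rw [Set.Finite.eventually_all hs]
    intro i hi
    by_cases hix : g i x = 0
    · filter_upwards [self_mem_nhdsWithin] with t ht
      simp [hix, hv i hi, (Set.mem_Ioi.1 ht).ne']
    · have hc : Continuous fun t : ℝ => g i (x + t • v) := by
        have := LinearMap.continuous_of_finiteDimensional (g i)
        fun_prop
      refine (hc.tendsto 0).eventually_ne ?_ |>.filter_mono nhdsWithin_le_nhds
      simpa using hix
  obtain ⟨t, ht, ht1⟩ := (hfin.and (Ioo_mem_nhdsGT hε)).exists
  have hpos : ∀ H ∈ A.hyperplanes, 0 < N.f H x * N.f H (x + t • v) := by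
    intro H hH
    have h2 := h1 H hH
    have h3 : 0 < N.f H x ^ 2 := by have := hx0 H hH; positivity
    simp only [map_add, map_smul, smul_eq_mul] at h2 ⊢
    -- The product is affine in `t` and positive at both `0` and `ε`, hence positive in between.
    have h4 : ε * (N.f H x * (N.f H x + t * N.f H v)) =
        (ε - t) * N.f H x ^ 2 + t * (N.f H x * (N.f H x + ε * N.f H v)) := by ring
    have h5 : 0 < ε * (N.f H x * (N.f H x + t * N.f H v)) := by
      rw [h4]
      have := mul_pos (sub_pos.2 ht1.2) h3
      have := mul_pos ht1.1 h2
      linarith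
    exact pos_of_mul_pos_right h5 hε.le
  refine ⟨x + t • v, (hcomp _ hpos).1, (hcomp _ hpos).2, fun H hH K hK hne h => ?_⟩
  refine ht (H, K) ⟨⟨hH, hK⟩, hne⟩ ?_
  simp only [g, LinearMap.sub_apply, LinearMap.smul_apply, smul_eq_mul]
  linarith

/-! ### Facet points, cut hyperplanes and shards -/

/-- `q` lies on `H` and on no other hyperplane, and off `H` it has the separating set of `R`. -/
structure Normals.IsFacetPoint (N : Normals A B) (H : Submodule ℝ (Euc n)) (q : Euc n)
    (R : Region A) : Prop where
  hyperplane_mem : H ∈ A.hyperplanes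
  mem : q ∈ H
  ne_zero : ∀ K ∈ A.hyperplanes, K ≠ H → N.f K q ≠ 0
  mem_sepSet : ∀ K ∈ A.hyperplanes, K ≠ H → (K ∈ sepSet A B R ↔ N.f K q < 0)

theorem mem_cutHyperplane_of_generic {H : Submodule ℝ (Euc n)} {q : Euc n} (hq : q ∈ H)
    (h : ∀ K ∈ A.hyperplanes, K ≠ H → q ∉ K) : q ∈ cutHyperplane B H := by
  refine ⟨hq, ?_⟩
  rintro _ L ⟨-, rfl, hnt⟩ hH - hqL
  obtain ⟨K, hK, hne⟩ := hnt.exists_ne H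
  exact h K hK.1 hne (hK.2 hqL)

theorem Normals.IsFacetPoint.mem_cutHyperplane {N : Normals A B} {H : Submodule ℝ (Euc n)}
    {q : Euc n} {R : Region A} (h : N.IsFacetPoint H q R) : q ∈ cutHyperplane B H :=
  mem_cutHyperplane_of_generic h.mem fun K hK hne hq =>
    h.ne_zero K hK hne ((N.apply_eq_zero_iff hK).2 hq)

/-- Regions on both sides of a generic point of a hyperplane. -/
theorem Normals.exists_sides (N : Normals A B) {H : Submodule ℝ (Euc n)}
    (hH : H ∈ A.hyperplanes) {q : Euc n} (hq : q ∈ H)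
    (hne : ∀ K ∈ A.hyperplanes, K ≠ H → N.f K q ≠ 0) :
    (∃ R, N.IsFacetPoint H q R ∧ H ∈ sepSet A B R) ∧
      ∃ R, N.IsFacetPoint H q R ∧ H ∉ sepSet A B R := by
  have key : ∀ v, N.f H v ≠ 0 →
      ∃ R, N.IsFacetPoint H q R ∧ (H ∈ sepSet A B R ↔ N.f H v < 0) := by
    intro v hv
    obtain ⟨ε, hε, h1⟩ := exists_pos_same_sign (s := A.hyperplanes \ {H})
      (A.finite.subset Set.sdiff_subset) N.f q v fun K hK => hne K hK.1 hK.2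
    have hfH : N.f H (q + ε • v) = ε * N.f H v := by
      simp [(N.apply_eq_zero_iff hH).2 hq]
    have hx : q + ε • v ∈ complement A.hyperplanes := by
      intro K hK h0
      rw [← N.apply_eq_zero_iff hK] at h0
      by_cases hKH : K = H
      · subst hKH
        rw [hfH] at h0
        exact mul_ne_zero hε.ne' hv h0
      · have := h1 K ⟨hK, hKH⟩
        simp [h0] at this
    obtain ⟨R, hR⟩ : ∃ R : Region A,
        R.1 = closure (connectedComponentIn (complement A.hyperplanes) (q + ε • v)) :=
      ⟨⟨_, _, hx, rfl⟩, rfl⟩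
    refine ⟨R, ⟨hH, hq, hne, fun K hK hKH => ?_⟩, ?_⟩
    · rw [N.mem_sepSet_iff hx hR hK]
      have h2 := h1 K ⟨hK, hKH⟩
      constructor <;> intro h3
      · exact neg_of_mul_pos_left h2 h3.le
      · exact neg_of_mul_pos_right h2 h3.le
    · rw [N.mem_sepSet_iff hx hR hH, hfH]
      exact ⟨fun h => by
        by_contra h3
        have := mul_nonneg hε.le (not_lt.1 h3)
        linarith, fun h => mul_neg_of_pos_of_neg hε h⟩
  have hb := N.pos H hH
  constructor
  · obtain ⟨R, h1, h2⟩ := key (-N.b) (by simpa using hb.ne')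
    exact ⟨R, h1, h2.2 (by simpa using hb)⟩
  · obtain ⟨R, h1, h2⟩ := key N.b hb.ne'
    exact ⟨R, h1, fun h => hb.not_gt (h2.1 h)⟩

theorem Shard.carrier_subset (σ : Shard A B) : σ.carrier ⊆ cutHyperplane B σ.hyperplane := by
  obtain ⟨x, -, h⟩ := σ.isComponent
  rw [h]
  exact connectedComponentIn_subset _ _

theorem Shard.mem_of_segment (σ : Shard A B) {p q : Euc n} (hp : p ∈ σ.carrier)
    (h : segment ℝ p q ⊆ cutHyperplane B σ.hyperplane) : q ∈ σ.carrier := by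
  obtain ⟨x, -, hx⟩ := σ.isComponent
  rw [hx] at hp ⊢
  rw [connectedComponentIn_eq hp]
  exact (convex_segment p q).isPreconnected.subset_connectedComponentIn
    (left_mem_segment ℝ p q) h (right_mem_segment ℝ p q)

/-- Basicness test: `H` bounds the base region of a subarrangement if some point of `H` lies on
the base side of all its other hyperplanes. -/
theorem Normals.isBasic_of_pos (N : Normals A B) {𝓗' : Set (Submodule ℝ (Euc n))}
    (h𝓗 : 𝓗' ⊆ A.hyperplanes) {H : Submodule ℝ (Euc n)} (hH : H ∈ 𝓗') {q : Euc n} (hq : q ∈ H)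
    (hpos : ∀ K ∈ 𝓗', K ≠ H → 0 < N.f K q) : IsBasic B 𝓗' H := by
  have hcompl : complement A.hyperplanes ⊆ complement 𝓗' := fun x hx K hK => hx K (h𝓗 hK)
  have hb := hcompl N.b_mem
  refine ⟨hH, _, ⟨N.b, hb, rfl⟩, ?_, ?_⟩
  · rw [N.base_eq]
    exact closure_mono (connectedComponentIn_mono _ hcompl)
  · refine hasCodimOne_of_same_sign (s := 𝓗' \ {H})
      (A.finite.subset (Set.sdiff_subset.trans h𝓗)) N.f (A.codim_one H (h𝓗 hH))
      Set.inter_subset_right hq (fun K hK => (hpos K hK.1 hK.2).ne') fun y hy h => ⟨?_, hy⟩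
    rw [mem_closure_component_iff N.f (fun K hK => N.ker_eq K (h𝓗 hK)) hb]
    intro K hK
    have hbK := N.pos K (h𝓗 hK)
    by_cases hKH : K = H
    · subst hKH
      rw [(N.apply_eq_zero_iff (h𝓗 hK)).2 hy, mul_zero]
    · exact mul_nonneg hbK.le (pos_of_mul_pos_right (h K ⟨hK, hKH⟩) (hpos K hK hKH).le).le

/-- A segment in `H` along which the separating set only decreases is not cut. -/
theorem Normals.IsFacetPoint.segment_subset {N : Normals A B} {H : Submodule ℝ (Euc n)}
    {p q : Euc n} {R R' : Region A} (hp : N.IsFacetPoint H p R) (hq : N.IsFacetPoint H q R')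
    (h : ∀ K ∈ A.hyperplanes, K ≠ H → K ∈ sepSet A B R' → K ∈ sepSet A B R) :
    segment ℝ p q ⊆ cutHyperplane B H := by
  rintro _ ⟨s, t, hs, ht, hst, rfl⟩
  refine ⟨H.add_mem (H.smul_mem s hp.mem) (H.smul_mem t hq.mem), ?_⟩
  rintro _ L ⟨-, rfl, -⟩ hH hnb hL
  -- If some other `K` containing `L` were negative at `q`, nestedness would make it negative at `p`
  -- and so on the whole segment, yet it vanishes at the point of `L`. So all of them are positive
  -- at `q`, which makes `H` basic.
  refine hnb (N.isBasic_of_pos (fun K hK => hK.1) hH hq.mem ?_)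
  rintro K ⟨hK, hLK⟩ hne
  have h0 := (N.apply_eq_zero_iff hK).2 (hLK hL)
  simp only [map_add, map_smul, smul_eq_mul] at h0
  by_contra hneg
  have hq0 : N.f K q < 0 := lt_of_le_of_ne (not_lt.1 hneg) (hq.ne_zero K hK hne)
  have hp0 : N.f K p < 0 :=
    (hp.mem_sepSet K hK hne).1 (h K hK hne ((hq.mem_sepSet K hK hne).2 hq0))
  rcases hs.eq_or_lt with rfl | hs
  · have : t = 1 := by linarith
    subst this; linarith
  · have := mul_neg_of_pos_of_neg hs hp0
    have := mul_nonpos_of_nonneg_of_nonpos ht hq0.le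
    linarith

/-- The points of `H_Σ` with the same signs as `q` off `H_Σ` form a relatively open set. They stay
in the shard of `q`, since separating sets are constant along the segments to them. -/
theorem Normals.IsFacetPoint.hasCodimOne {N : Normals A B} {σ : Shard A B} {q : Euc n}
    {R : Region A} (h : N.IsFacetPoint σ.hyperplane q R) (hq : q ∈ σ.carrier) :
    HasCodimOne (R.1 ∩ σ.carrier) := by
  refine hasCodimOne_of_same_sign (s := A.hyperplanes \ {σ.hyperplane})
    (A.finite.subset Set.sdiff_subset) N.f (A.codim_one _ σ.hyperplane_mem)
    (fun x hx => (σ.carrier_subset hx.2).1) h.mem (fun K hK => h.ne_zero K hK.1 hK.2)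
    fun y hy hs => ?_
  have hfy : N.IsFacetPoint σ.hyperplane y R := by
    refine ⟨h.hyperplane_mem, hy, fun K hK hne => right_ne_zero_of_mul (hs K ⟨hK, hne⟩).ne',
      fun K hK hne => (h.mem_sepSet K hK hne).trans ?_⟩
    have h2 := hs K ⟨hK, hne⟩
    constructor <;> intro h3
    · exact neg_of_mul_pos_right h2 h3.le
    · exact neg_of_mul_pos_left h2 h3.le
  refine ⟨?_, σ.mem_of_segment hq (h.segment_subset hfy fun _ _ _ hK => hK)⟩
  obtain ⟨x, hx, hR⟩ := R.2
  rw [hR, mem_closure_component_iff N.f N.ker_eq hx]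
  intro K hK
  by_cases hKH : K = σ.hyperplane
  · subst hKH
    rw [(N.apply_eq_zero_iff hK).2 hy, mul_zero]
  · have h1 := (N.mem_sepSet_iff hx hR hK).symm.trans (hfy.mem_sepSet K hK hKH)
    rcases lt_or_ge (N.f K x) 0 with h2 | h2
    · exact (mul_pos_of_neg_of_neg h2 (h1.1 h2)).le
    · exact mul_nonneg h2 (not_lt.1 fun h3 => h2.not_gt (h1.2 h3))

/-- A set of codimension one in `H_Σ` lies in no other hyperplane, so each other `K` is avoided by
some point of `R ∩ Σ`. The sum `w` of such points avoids all of them at once with the signs of `R`.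
-/
theorem Normals.exists_isFacetPoint (N : Normals A B) {σ : Shard A B} {R : Region A}
    (h : HasCodimOne (R.1 ∩ σ.carrier)) :
    ∃ q ∈ σ.carrier, N.IsFacetPoint σ.hyperplane q R := by
  classical
  obtain ⟨x, hx, hR⟩ := R.2
  have hmem : ∀ y ∈ R.1 ∩ σ.carrier, ∀ K ∈ A.hyperplanes, 0 ≤ N.f K x * N.f K y := by
    intro y hy
    have := hy.1
    rwa [hR, mem_closure_component_iff N.f N.ker_eq hx] at this
  have hx0 : ∀ H ∈ A.hyperplanes, N.f H x ≠ 0 := fun H hH h =>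
    hx H hH ((N.apply_eq_zero_iff hH).1 h)
  have hsub : ∀ y ∈ R.1 ∩ σ.carrier, y ∈ σ.hyperplane := fun y hy => (σ.carrier_subset hy.2).1
  have hz : ∀ K, ∃ z, z ∈ R.1 ∩ σ.carrier ∧
      (K ∈ A.hyperplanes → K ≠ σ.hyperplane → N.f K z ≠ 0) := by
    intro K
    by_contra hcon
    push Not at hcon
    obtain ⟨y, hy⟩ := h.1
    obtain ⟨hK, hne, -⟩ := hcon y hy
    refine hne (eq_of_hasCodimOne (A.codim_one _ σ.hyperplane_mem) (A.codim_one K hK) h hsub ?_)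
    intro z hz
    exact (N.apply_eq_zero_iff hK).1 (hcon z hz).2.2
  choose z hzm hz0 using hz
  obtain ⟨p, hp⟩ := h.1
  set w := ∑ K ∈ A.finite.toFinset, z K with hw
  have hwH : w ∈ σ.hyperplane := Submodule.sum_mem _ fun K _ => hsub _ (hzm K)
  have hwpos : ∀ K ∈ A.hyperplanes, K ≠ σ.hyperplane → 0 < N.f K x * N.f K w := by
    intro K hK hne
    rw [hw, map_sum, Finset.mul_sum]
    refine Finset.sum_pos' (fun K' _ => hmem _ (hzm K') K hK) ⟨K, by simpa using hK, ?_⟩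
    exact lt_of_le_of_ne (hmem _ (hzm K) K hK) (mul_ne_zero (hx0 K hK) (hz0 K hK hne)).symm
  have hpos : ∀ t : ℝ, 0 < t → ∀ K ∈ A.hyperplanes, K ≠ σ.hyperplane →
      0 < N.f K x * N.f K (p + t • w) := by
    intro t ht K hK hne
    have h1 := mul_pos ht (hwpos K hK hne)
    have h2 := hmem p hp K hK
    simp only [map_add, map_smul, smul_eq_mul]
    linarith
  have hin : ∀ t : ℝ, p + t • w ∈ σ.hyperplane := fun t =>
    Submodule.add_mem _ (hsub p hp) (Submodule.smul_mem _ t hwH)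
  -- Convexity of the shard is not used: the half-open segment from `p` is generic in `H_Σ`, so it
  -- stays in the component of `p`. The coefficient `1` is arbitrary.
  refine ⟨p + (1 : ℝ) • w, σ.mem_of_segment hp.2 ?_, σ.hyperplane_mem, hin 1, ?_, ?_⟩
  · rintro _ ⟨s, t, hs, ht, hst, rfl⟩
    have heq : s • p + t • (p + (1 : ℝ) • w) = p + t • w := by
      rw [one_smul, smul_add, ← add_assoc, ← add_smul, hst, one_smul]
    rw [heq]
    rcases ht.eq_or_lt with rfl | ht
    · simpa using σ.carrier_subset hp.2
    · refine mem_cutHyperplane_of_generic (hin t) fun K hK hne h0 => ?_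
      have := hpos t ht K hK hne
      rw [(N.apply_eq_zero_iff hK).2 h0, mul_zero] at this
      exact this.false
  · exact fun K hK hne => right_ne_zero_of_mul (hpos 1 one_pos K hK hne).ne'
  · intro K hK hne
    rw [N.mem_sepSet_iff hx hR hK]
    have h2 := hpos 1 one_pos K hK hne
    constructor <;> intro h3
    · exact neg_of_mul_pos_right h2 h3.le
    · exact neg_of_mul_pos_left h2 h3.le

/-! ### Sliding along the base direction -/

/-- Moving a generic point along `b` onto a hyperplane `H` meets no other hyperplane. -/
theorem Normals.exists_projection (N : Normals A B) {x : Euc n}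
    (hgen : ∀ H ∈ A.hyperplanes, ∀ K ∈ A.hyperplanes, K ≠ H →
        N.f K x * N.f H N.b ≠ N.f H x * N.f K N.b)
    {H : Submodule ℝ (Euc n)} (hH : H ∈ A.hyperplanes) :
    ∃ q ∈ H, (∀ K ∈ A.hyperplanes, K ≠ H → N.f K q ≠ 0) ∧
      ∀ K ∈ A.hyperplanes,
        N.f K q = N.f K N.b * (N.f K x / N.f K N.b - N.f H x / N.f H N.b) := by
  have hval : ∀ K ∈ A.hyperplanes, N.f K (x - (N.f H x / N.f H N.b) • N.b) =
      N.f K N.b * (N.f K x / N.f K N.b - N.f H x / N.f H N.b) := by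
    intro K hK
    have := (N.pos K hK).ne'
    simp only [map_sub, map_smul, smul_eq_mul]
    field_simp
  refine ⟨_, ?_, fun K hK hne h0 => hgen H hH K hK hne ?_, hval⟩
  · rw [← N.apply_eq_zero_iff hH, hval H hH, sub_self, mul_zero]
  · have h1 := (N.pos K hK).ne'
    have h2 := (N.pos H hH).ne'
    rw [hval K hK] at h0
    have h3 := sub_eq_zero.1 ((mul_eq_zero.1 h0).resolve_left h1)
    rwa [div_eq_div_iff h1 h2] at h3

/-- A region below an element of `U(Σ)` with `H_Σ` in its separating set lies above an element
of `U(Σ)`. -/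
theorem Normals.exists_upperRegions_le (N : Normals A B) {σ : Shard A B}
    {J K : PosetOfRegions A B} (hJ : J ∈ upperRegions σ) (hKJ : K ≤ J)
    (hK : σ.hyperplane ∈ sepSet A B K) : ∃ R ∈ upperRegions σ, R ≤ K := by
  obtain ⟨p, hp, hpJ⟩ := N.exists_isFacetPoint hJ.1
  obtain ⟨x, hx, hxK, hgen⟩ := N.exists_generic K
  have hH := σ.hyperplane_mem
  obtain ⟨q, hq, hne, hval⟩ := N.exists_projection hgen hH
  obtain ⟨R, hR, hHR⟩ := (N.exists_sides hH hq hne).1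
  have hRK : ∀ K' ∈ A.hyperplanes, K' ≠ σ.hyperplane →
      K' ∈ sepSet A B R → K' ∈ sepSet A B K := by
    intro K' hK' hne' h
    have h1 := (hR.mem_sepSet K' hK' hne').1 h
    -- Here `q` is `x` plus a positive multiple of `b`, so a normal negative at `q` was already
    -- negative at `x`.
    have h2 := div_neg_of_neg_of_pos ((N.mem_sepSet_iff hx hxK hH).1 hK) (N.pos _ hH)
    rw [hval K' hK'] at h1
    have hb := N.pos K' hK'
    have h3 := neg_of_mul_neg_right h1 hb.le
    rw [N.mem_sepSet_iff hx hxK hK']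
    by_contra h4
    have := div_nonneg (not_lt.1 h4) hb.le
    linarith
  have hqσ := σ.mem_of_segment hp
    (hpJ.segment_subset hR fun K' hK' hne' h => hKJ (hRK K' hK' hne' h))
  refine ⟨R, ⟨hR.hasCodimOne hqσ, hHR⟩, fun K' h => ?_⟩
  by_cases hne' : K' = σ.hyperplane
  · exact hne' ▸ hK
  · exact hRK K' h.1 hne' h

/-- A region above an element of `L(Σ)` with `H_Σ` not in its separating set lies below an
element of `L(Σ)`. -/
theorem Normals.exists_le_lowerRegions (N : Normals A B) {σ : Shard A B}
    {M K : PosetOfRegions A B} (hM : M ∈ lowerRegions σ) (hMK : M ≤ K)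
    (hK : σ.hyperplane ∉ sepSet A B K) : ∃ R ∈ lowerRegions σ, K ≤ R := by
  obtain ⟨p, hp, hpM⟩ := N.exists_isFacetPoint hM.1
  obtain ⟨x, hx, hxK, hgen⟩ := N.exists_generic K
  have hH := σ.hyperplane_mem
  obtain ⟨q, hq, hne, hval⟩ := N.exists_projection hgen hH
  obtain ⟨R, hR, hHR⟩ := (N.exists_sides hH hq hne).2
  have hKR : ∀ K' ∈ A.hyperplanes, K' ≠ σ.hyperplane →
      K' ∈ sepSet A B K → K' ∈ sepSet A B R := by
    intro K' hK' hne' h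
    have h1 := (N.mem_sepSet_iff hx hxK hK').1 h
    rw [N.mem_sepSet_iff hx hxK hH] at hK
    have h2 := div_nonneg (not_lt.1 hK) (N.pos _ hH).le
    have h3 := div_neg_of_neg_of_pos h1 (N.pos K' hK')
    rw [hR.mem_sepSet K' hK' hne', hval K' hK']
    exact mul_neg_of_pos_of_neg (N.pos K' hK') (by linarith)
  -- The segment runs from `q` to `p`, because the larger separating set now belongs to `R`.
  have hseg := hR.segment_subset hpM fun K' hK' hne' h => hKR K' hK' hne' (hMK h)
  have hqσ := σ.mem_of_segment hp (segment_symm ℝ p q ▸ hseg)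
  refine ⟨R, ⟨hR.hasCodimOne hqσ, hHR⟩, fun K' h => ?_⟩
  by_cases hne' : K' = σ.hyperplane
  · exact absurd (hne' ▸ h) hK
  · exact hKR K' h.1 hne' h

/-- A nonempty separating set contains the hyperplane of a facet. -/
theorem Normals.exists_lower_facet (N : Normals A B) {J : PosetOfRegions A B}
    (hJ : (sepSet A B J).Nonempty) :
    ∃ H ∈ sepSet A B J, ∃ q, N.IsFacetPoint H q J := by
  obtain ⟨x, hx, hxJ, hgen⟩ := N.exists_generic J
  -- `H` is the first hyperplane crossed when moving from `x` in direction `b`.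
  obtain ⟨H, hHJ, hmax⟩ := Set.exists_max_image (sepSet A B J)
    (fun H => N.f H x / N.f H N.b) (A.finite.subset (sepSet_subset J)) hJ
  have hH := sepSet_subset J hHJ
  obtain ⟨q, hq, hne, hval⟩ := N.exists_projection hgen hH
  refine ⟨H, hHJ, q, hH, hq, hne, fun K hK hKH => ⟨fun h => ?_, fun h => ?_⟩⟩
  · refine lt_of_le_of_ne ?_ (hne K hK hKH)
    rw [hval K hK]
    exact mul_nonpos_of_nonneg_of_nonpos (N.pos K hK).le (sub_nonpos.2 (hmax K h))
  · rw [hval K hK] at h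
    have h1 := neg_of_mul_neg_right h (N.pos K hK).le
    have h2 := div_neg_of_neg_of_pos ((N.mem_sepSet_iff hx hxJ hH).1 hHJ) (N.pos H hH)
    rw [N.mem_sepSet_iff hx hxJ hK]
    by_contra h3
    have := div_nonneg (not_lt.1 h3) (N.pos K hK).le
    linarith

/-- The complement of a separating set, if nonempty, contains the hyperplane of a facet. -/
theorem Normals.exists_upper_facet (N : Normals A B) {M : PosetOfRegions A B}
    (hM : (A.hyperplanes \ sepSet A B M).Nonempty) :
    ∃ H ∉ sepSet A B M, ∃ q, N.IsFacetPoint H q M := by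
  obtain ⟨x, hx, hxM, hgen⟩ := N.exists_generic M
  -- `H` is the first hyperplane crossed when moving from `x` in direction `-b`.
  obtain ⟨H, ⟨hH, hHM⟩, hmin⟩ := Set.exists_min_image (A.hyperplanes \ sepSet A B M)
    (fun H => N.f H x / N.f H N.b) (A.finite.subset Set.sdiff_subset) hM
  obtain ⟨q, hq, hne, hval⟩ := N.exists_projection hgen hH
  refine ⟨H, hHM, q, hH, hq, hne, fun K hK hKH => ⟨fun h => ?_, fun h => ?_⟩⟩
  · rw [N.mem_sepSet_iff hx hxM hH] at hHM
    have h1 := div_nonneg (not_lt.1 hHM) (N.pos H hH).le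
    have h2 := div_neg_of_neg_of_pos ((N.mem_sepSet_iff hx hxM hK).1 h) (N.pos K hK)
    rw [hval K hK]
    exact mul_neg_of_pos_of_neg (N.pos K hK) (by linarith)
  · by_contra h1
    have h2 := mul_nonneg (N.pos K hK).le (sub_nonneg.2 (hmin K ⟨hK, h1⟩))
    rw [← hval K hK] at h2
    linarith

/-! ### Covers and subcritical pairs -/

/-- `IsFacetPoint` leaves the side of `H` open, so one point serves both adjacent regions, whose
separating sets differ only in `H`. -/
theorem Normals.IsFacetPoint.mem_sepSet_congr {N : Normals A B} {H K : Submodule ℝ (Euc n)}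
    {q : Euc n} {R R' : Region A} (h : N.IsFacetPoint H q R) (h' : N.IsFacetPoint H q R')
    (hne : K ≠ H) : K ∈ sepSet A B R ↔ K ∈ sepSet A B R' :=
  ⟨fun hK => (h'.mem_sepSet K hK.1 hne).2 ((h.mem_sepSet K hK.1 hne).1 hK),
    fun hK => (h.mem_sepSet K hK.1 hne).2 ((h'.mem_sepSet K hK.1 hne).1 hK)⟩

/-- The region across a lower facet. -/
theorem Normals.IsFacetPoint.exists_lower {N : Normals A B} {H : Submodule ℝ (Euc n)}
    {q : Euc n} {J : PosetOfRegions A B} (h : N.IsFacetPoint H q J) :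
    ∃ J' : PosetOfRegions A B, sepSet A B J' = sepSet A B J \ {H} := by
  obtain ⟨J', hJ', hHJ'⟩ := (N.exists_sides h.hyperplane_mem h.mem h.ne_zero).2
  refine ⟨J', Set.ext fun K => ?_⟩
  by_cases hne : K = H
  · subst hne
    simpa using hHJ'
  · simpa [hne] using hJ'.mem_sepSet_congr h hne

/-- The region across an upper facet. -/
theorem Normals.IsFacetPoint.exists_upper {N : Normals A B} {H : Submodule ℝ (Euc n)}
    {q : Euc n} {M : PosetOfRegions A B} (h : N.IsFacetPoint H q M) :
    ∃ M' : PosetOfRegions A B, sepSet A B M' = insert H (sepSet A B M) := by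
  obtain ⟨M', hM', hHM'⟩ := (N.exists_sides h.hyperplane_mem h.mem h.ne_zero).1
  refine ⟨M', Set.ext fun K => ?_⟩
  by_cases hne : K = H
  · subst hne
    simpa using hHM'
  · simpa [hne] using hM'.mem_sepSet_congr h hne

theorem isLowerStar_of_sepSet_eq {J J' : PosetOfRegions A B} {H : Submodule ℝ (Euc n)}
    (hHJ : H ∈ sepSet A B J) (hJ' : sepSet A B J' = sepSet A B J \ {H})
    (h : ∀ K < J, H ∉ sepSet A B K) : IsLowerStar J J' := by
  have hle : ∀ K < J, K ≤ J' := fun K hK => by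
    rw [le_iff_sepSet_subset, hJ']
    exact Set.subset_sdiff_singleton hK.le (h K hK)
  have hlt : J' < J := by
    refine lt_of_le_of_ne (by rw [le_iff_sepSet_subset, hJ']; exact Set.sdiff_subset) ?_
    rintro rfl
    have := hJ' ▸ hHJ
    exact this.2 rfl
  exact ⟨⟨hlt, fun c h1 h2 => (hle c h2).not_gt h1⟩,
    fun k hk => ((hle k hk.lt).eq_or_lt).resolve_right fun h1 => hk.2 h1 hlt⟩

/-- Otherwise some `R ∈ U(Σ)` satisfies `R ≤ K < J`, against the minimality of `J`. -/
theorem notMem_sepSet_of_lt_minimal {σ : Shard A B} {J : PosetOfRegions A B}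
    (hJ : Minimal (· ∈ upperRegions σ) J) {K : PosetOfRegions A B} (hK : K < J) :
    σ.hyperplane ∉ sepSet A B K := by
  obtain ⟨N⟩ := exists_normals A B
  intro h
  obtain ⟨R, hR, hRK⟩ := N.exists_upperRegions_le hJ.prop hK.le h
  exact hK.not_ge ((hJ.le_of_le hR (hRK.trans hK.le)).trans hRK)

theorem mem_sepSet_of_maximal_lt {σ : Shard A B} {M : PosetOfRegions A B}
    (hM : Maximal (· ∈ lowerRegions σ) M) {K : PosetOfRegions A B} (hK : M < K) :
    σ.hyperplane ∈ sepSet A B K := by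
  obtain ⟨N⟩ := exists_normals A B
  by_contra h
  obtain ⟨R, hR, hKR⟩ := N.exists_le_lowerRegions hM.prop hK.le h
  exact hK.not_ge (hKR.trans (hM.le_of_ge hR (hK.le.trans hKR)))

/-- A minimal element of `U(Σ)` covers exactly one region. -/
theorem exists_isLowerStar_of_minimal {σ : Shard A B} {J : PosetOfRegions A B}
    (hJ : Minimal (· ∈ upperRegions σ) J) :
    ∃ J', IsLowerStar J J' ∧ sepSet A B J' = sepSet A B J \ {σ.hyperplane} := by
  obtain ⟨N⟩ := exists_normals A B
  obtain ⟨p, -, hpJ⟩ := N.exists_isFacetPoint hJ.prop.1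
  obtain ⟨J', hJ'⟩ := hpJ.exists_lower
  exact ⟨J', isLowerStar_of_sepSet_eq hJ.prop.2 hJ'
    fun _ => notMem_sepSet_of_lt_minimal hJ, hJ'⟩

theorem isSubcritical_of_shard {σ : Shard A B} {J M Jstar : PosetOfRegions A B}
    (hJ : Minimal (· ∈ upperRegions σ) J) (hM : Maximal (· ∈ lowerRegions σ) M)
    (hstar : IsLowerStar J Jstar) (hle : Jstar ≤ M) : IsSubcritical J M := by
  obtain ⟨J', hJ'star, hJ'⟩ := exists_isLowerStar_of_minimal hJ
  obtain rfl := hstar.2 J' hJ'star.1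
  refine ⟨fun h => hM.prop.2 (h hJ.prop.2), fun x hx => ?_, fun x hx K hK => ?_⟩
  · refine le_trans ?_ hle
    rw [le_iff_sepSet_subset, hJ']
    exact Set.subset_sdiff_singleton hx.le (notMem_sepSet_of_lt_minimal hJ hx)
  -- `S(J)` is `S(J_*)` together with `H_Σ`: the first part comes from `J_* ≤ M`, and `H_Σ` is
  -- gained because `x` is strictly above `M`.
  · by_cases hne : K = σ.hyperplane
    · exact hne ▸ mem_sepSet_of_maximal_lt hM hx
    · exact hx.le (hle (hJ' ▸ ⟨hK, hne⟩ : K ∈ sepSet A B J'))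

theorem exists_shard_of_isSubcritical {J M : PosetOfRegions A B} (h : IsSubcritical J M) :
    ∃ σ : Shard A B, Minimal (· ∈ upperRegions σ) J ∧ Maximal (· ∈ lowerRegions σ) M ∧
      ∃ Jstar, IsLowerStar J Jstar ∧ Jstar ≤ M := by
  obtain ⟨N⟩ := exists_normals A B
  obtain ⟨hJM, hlow, hup⟩ := h
  obtain ⟨H₀, hH₀J, hH₀M⟩ := Set.not_subset.1 hJM
  obtain ⟨H, hHJ, p, hp⟩ := N.exists_lower_facet ⟨H₀, hH₀J⟩
  obtain ⟨H', hH'M, q, hq⟩ := N.exists_upper_facet ⟨H₀, hH₀J.1, hH₀M⟩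
  obtain ⟨J', hJ'⟩ := hp.exists_lower
  obtain ⟨M', hM'⟩ := hq.exists_upper
  have hJ'J : J' < J := by
    refine lt_of_le_of_ne (by rw [le_iff_sepSet_subset, hJ']; exact Set.sdiff_subset) ?_
    rintro rfl
    have := hJ' ▸ hHJ
    exact this.2 rfl
  have hMM' : M < M' := by
    refine lt_of_le_of_ne (by rw [le_iff_sepSet_subset, hM']; exact Set.subset_insert _ _) ?_
    rintro rfl
    exact hH'M (hM' ▸ Set.mem_insert _ _)
  have hJ'M := hlow J' hJ'J
  have hsub : ∀ K, K ≠ H → K ∈ sepSet A B J → K ∈ sepSet A B M := fun K hne hK =>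
    hJ'M (hJ' ▸ ⟨hK, hne⟩ : K ∈ sepSet A B J')
  have hHM : H ∉ sepSet A B M := fun hH => hJM fun K hK => by
    by_cases hne : K = H
    · exact hne ▸ hH
    · exact hsub K hne hK
  -- Since `J ≤ M'`, `H` lies in `S(M') = S(M) ∪ {H'}` but not in `S(M)`.
  obtain rfl : H = H' := by
    have h1 : H ∈ sepSet A B M' := hup M' hMM' hHJ
    rw [hM'] at h1
    exact h1.resolve_right hHM
  -- The shard through `p` also contains `q`, because off `H` the set `S(J)` is contained in `S(M)`.
  let σ : Shard A B := ⟨H, hHJ.1, _, p, hp.mem_cutHyperplane, rfl⟩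
  have hpσ : p ∈ σ.carrier := mem_connectedComponentIn hp.mem_cutHyperplane
  have hqσ : q ∈ σ.carrier := σ.mem_of_segment hpσ (segment_symm ℝ q p ▸
    hq.segment_subset hp fun K _ hne hK => hsub K hne hK)
  have hbelow : ∀ K < J, H ∉ sepSet A B K := fun K hK hH => hHM (hlow K hK hH)
  refine ⟨σ, ⟨⟨hp.hasCodimOne (σ := σ) hpσ, hHJ⟩, fun K hK hKJ => ?_⟩,
    ⟨⟨hq.hasCodimOne (σ := σ) hqσ, hHM⟩, fun K hK hMK => ?_⟩,
    J', isLowerStar_of_sepSet_eq hHJ hJ' hbelow, hJ'M⟩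
  · rcases hKJ.eq_or_lt with rfl | hlt
    · exact le_rfl
    · exact absurd hK.2 (hbelow K hlt)
  · rcases hMK.eq_or_lt with rfl | hlt
    · exact le_rfl
    -- A region strictly above `M` is above `J`, so it has `H` in its separating set and is not in
    -- `L(Σ)`.
    · exact absurd (hup K hlt hHJ) hK.2

end Facets

end RegionPoset

theorem mainTheorem7 {n : ℕ} (A : RegionPoset.CentralArrangement n) (B : RegionPoset.Region A) :
    (∀ (σ : RegionPoset.Shard A B) (J : RegionPoset.PosetOfRegions A B),
      Minimal (· ∈ RegionPoset.upperRegions σ) J →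
        ∃ Jstar, RegionPoset.IsLowerStar J Jstar) ∧
    (∀ J M : RegionPoset.PosetOfRegions A B,
      RegionPoset.IsSubcritical J M ↔
        ∃ σ : RegionPoset.Shard A B,
          Minimal (· ∈ RegionPoset.upperRegions σ) J ∧
          Maximal (· ∈ RegionPoset.lowerRegions σ) M ∧
          ∃ Jstar, RegionPoset.IsLowerStar J Jstar ∧ Jstar ≤ M) := by
  refine ⟨fun σ J hJ => ?_, fun J M => ⟨RegionPoset.exists_shard_of_isSubcritical, ?_⟩⟩
  · obtain ⟨J', h, -⟩ := RegionPoset.exists_isLowerStar_of_minimal hJ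
    exact ⟨J', h⟩
  · rintro ⟨σ, hJ, hM, Jstar, hstar, hle⟩
    exact RegionPoset.isSubcritical_of_shard hJ hM hstar hle
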